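/- All graphs are finite and simple. The stability number $\alpha(G)$ of a graph $G$ is the maximum size of a stable set of $G$, that is, of a set of pairwise non-adjacent vertices; a stable set of size $\alpha(G)$ is called a stability system of $G$. $G$ is called $\alpha$-stable if $\alpha(G-e)=\alpha(G)$ for every edge $e$ of $G$ and $\alpha(G+e)=\alpha(G)$ for every edge $e$ of the complement of $G$. A bipartite graph with colour classes $A,B$ is called bistable if it has exactly two stability systems, namely $A$ and $B$. A perfect matching of $G$ is a set of pairwise non-incident edges covering all vertices, and a cycle of $G$ is called alternating if, for some perfect matching $M$ of $G$, its edges are alternately in $M$ and not in $M$. Theorem 5.6. Let $G$ be a connected bipartite graph with at least two vertices. Then the following assertions are equivalent: (i) $G$ is $\alpha$-stable; (ii) for some $k\ge 1$, the vertex set of $G$ can be partitioned into sets $V_1,\dots,V_k$ such that each induced subgraph $G_i=G[V_i]$, $1\le i\le k$, is bistable bipartite and has at least $4$ vertices; (iii) $G$ has a perfect matching, and the intersection of all perfect matchings of $G$ (as sets of edges) is empty; (iv) every vertex of $G$ is incident to at least two edges each of which is contained in some perfect matching of $G$; (v) every vertex of $G$ belongs to some alternating cycle of $G$. -/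

import Mathlib

namespace AlphaStable

variable {V : Type*}

/-- Deleting any edge of `G` leaves the stability number unchanged. -/
def IsAlphaMinusStable (G : SimpleGraph V) : Prop :=
  ∀ e ∈ G.edgeSet, (G.deleteEdges {e}).indepNum = G.indepNum

/-- Adding any edge of the complement of `G` leaves the stability number unchanged. -/
def IsAlphaPlusStable (G : SimpleGraph V) : Prop :=
  ∀ e ∈ Gᶜ.edgeSet, (G ⊔ SimpleGraph.fromEdgeSet {e}).indepNum = G.indepNum

/-- `G` is `α`-stable: both `α⁻`-stable and `α⁺`-stable. -/
def IsAlphaStable (G : SimpleGraph V) : Prop :=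
  IsAlphaMinusStable G ∧ IsAlphaPlusStable G

/-- `G` is bistable bipartite: it has a bipartition into colour classes `A`, `B`, and it has exactly
two stability systems (stable sets of maximum size), namely `A` and `B`. -/
def IsBistableBipartite [Finite V] (G : SimpleGraph V) : Prop :=
  ∃ A B : Finset V,
    G.IsBipartiteWith (A : Set V) (B : Set V) ∧ (A : Set V) ∪ (B : Set V) = Set.univ ∧
    A ≠ B ∧ ∀ S : Finset V, G.IsMaximumIndepSet S ↔ S = A ∨ S = B

/-- The vertex set of `G` is partitioned into `k ≥ 1` sets, each of which spans a bistable
bipartite subgraph on at least four vertices. -/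
def HasBistableDecomposition [Finite V] (G : SimpleGraph V) : Prop :=
  ∃ (k : ℕ) (U : Fin k → Set V), 1 ≤ k ∧
    Pairwise (fun i j => Disjoint (U i) (U j)) ∧ (⋃ i, U i) = Set.univ ∧
    ∀ i, IsBistableBipartite (G.induce (U i)) ∧ 4 ≤ (U i).ncard

/-- The closed walk `p` is an alternating cycle: a cycle for which some perfect matching `M` of `G`
contains exactly one of any two consecutive edges. (At each vertex of a cycle there are exactly two
edges of the cycle, and `SimpleGraph.IsAlternating` says that exactly one of them is in `M`.) -/
def IsAlternatingCycle (G : SimpleGraph V) {u : V} (p : G.Walk u u) : Prop :=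
  p.IsCycle ∧ ∃ M : G.Subgraph, M.IsPerfectMatching ∧
    p.toSubgraph.spanningCoe.IsAlternating M.spanningCoe

end AlphaStable

namespace AlphaStable

open Finset

/-! All five conditions are compared with `AvoidsPairs`: a perfect matching exists and no edge lies
in all of them. In a bipartite graph a perfect matching certifies that both colour classes are
maximum stable sets, and Hall's theorem gives the converse.

From `α`-stability: adding edges shows that at most one vertex lies in every maximum stable set. The
lattice of these sets then makes both classes maximum, and this survives deletion of an edge, so the
remaining graph still has a perfect matching.

For the decomposition, the parts are the components of `matchableGraph G`. A maximum stable set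
contains exactly one end of each matchable edge, so on a component it is one of the two classes.
Conversely, matchings of bistable parts that avoid a given pair are glued.

Alternating cycles arise from the symmetric difference of two perfect matchings; switching a
matching along such a cycle gives the second one. -/

/-- `f` sends every vertex to its partner in some perfect matching of `G`. -/
structure IsPartnerMap {V : Type*} (G : SimpleGraph V) (f : V → V) : Prop where
  apply_apply : ∀ v, f (f v) = v
  adj : ∀ v, G.Adj v (f v)

/-- Every pair of vertices is avoided by the partner map of some perfect matching of `G`. -/
def AvoidsPairs {V : Type*} (G : SimpleGraph V) : Prop :=
  ∀ x y : V, ∃ f, IsPartnerMap G f ∧ f x ≠ y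

/-- `A` and `B` are the colour classes of a bipartition of all vertices of `G`. -/
structure IsBipartition {V : Type*} (G : SimpleGraph V) (A B : Finset V) : Prop where
  toIsBipartiteWith : G.IsBipartiteWith (A : Set V) (B : Set V)
  cover : ∀ v, v ∈ A ∨ v ∈ B

/-! ### Partner maps, bipartitions and Hall's theorem -/

section Basic

variable {V : Type*} {G : SimpleGraph V} {A B : Finset V} {f : V → V}

lemma IsPartnerMap.mono {H : SimpleGraph V} (hf : IsPartnerMap G f) (h : G ≤ H) :
    IsPartnerMap H f :=
  ⟨hf.apply_apply, fun v => h (hf.adj v)⟩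

lemma exists_partnerMap_of_isPerfectMatching {M : G.Subgraph} (hM : M.IsPerfectMatching) :
    ∃ f, IsPartnerMap G f ∧ ∀ v w, M.Adj v w ↔ f v = w := by
  rw [SimpleGraph.Subgraph.isPerfectMatching_iff] at hM
  choose f hf hu using hM
  have key : ∀ v w, M.Adj v w ↔ f v = w := fun v w =>
    ⟨fun h => (hu v w h).symm, fun h => h ▸ hf v⟩
  exact ⟨f, ⟨fun v => (key _ _).1 (hf v).symm, fun v => (hf v).adj_sub⟩, key⟩

lemma IsPartnerMap.exists_isPerfectMatching (hf : IsPartnerMap G f) :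
    ∃ M : G.Subgraph, M.IsPerfectMatching ∧ ∀ v w, M.Adj v w ↔ f v = w := by
  refine ⟨{ verts := Set.univ, Adj := fun v w => f v = w, adj_sub := ?_, edge_vert := ?_,
            symm := ⟨?_⟩ }, ?_, fun _ _ => Iff.rfl⟩
  · rintro v w rfl; exact hf.adj v
  · intros; trivial
  · rintro v w rfl; exact hf.apply_apply v
  · rw [SimpleGraph.Subgraph.isPerfectMatching_iff]
    exact fun v => ⟨f v, rfl, fun w (h : f v = w) => h.symm⟩

lemma IsBipartition.symm (h : IsBipartition G A B) : IsBipartition G B A :=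
  ⟨h.toIsBipartiteWith.symm, fun v => (h.cover v).symm⟩

lemma IsBipartition.disjoint (h : IsBipartition G A B) : Disjoint A B :=
  Finset.disjoint_coe.1 h.toIsBipartiteWith.disjoint

lemma IsBipartition.mono {H : SimpleGraph V} (h : IsBipartition G A B) (hle : H ≤ G) :
    IsBipartition H A B :=
  ⟨⟨h.toIsBipartiteWith.disjoint, fun _ _ hvw => h.toIsBipartiteWith.mem_of_adj (hle hvw)⟩, h.cover⟩

lemma IsBipartition.mem_right_iff (h : IsBipartition G A B) (v : V) : v ∈ B ↔ v ∉ A :=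
  ⟨fun hb ha => Finset.disjoint_left.1 h.disjoint ha hb, (h.cover v).resolve_left⟩

lemma IsBipartition.mem_iff_of_adj (h : IsBipartition G A B) {v w : V} (hvw : G.Adj v w) :
    v ∈ A ↔ w ∉ A := by
  have := h.toIsBipartiteWith.mem_of_adj hvw
  have h1 := h.mem_right_iff v
  have h2 := h.mem_right_iff w
  simp only [Finset.mem_coe] at this
  tauto

lemma IsBipartition.isIndepSet_left (h : IsBipartition G A B) : G.IsIndepSet (A : Set V) := by
  intro v hv w hw _ hvw
  exact (h.mem_iff_of_adj hvw).1 hv hw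

lemma isIndepSet_mono {H : SimpleGraph V} (hle : H ≤ G) {S : Set V} (hS : G.IsIndepSet S) :
    H.IsIndepSet S :=
  fun _ hv _ hw hne hvw => hS hv hw hne (hle hvw)

lemma exists_isBipartition [Finite V] (h : G.IsBipartite) : ∃ A B, IsBipartition G A B := by
  classical
  have := Fintype.ofFinite V
  obtain ⟨c⟩ := h
  refine ⟨univ.filter (c · = 0), univ.filter (c · ≠ 0), ⟨?_, ?_⟩, ?_⟩
  · rw [Finset.disjoint_coe]
    exact Finset.disjoint_filter_filter_not _ _ _
  · intro v w hvw
    have := c.valid hvw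
    simp only [coe_filter, mem_univ, true_and, Set.mem_ofPred_eq]
    omega
  · intro v
    simpa using em _

/-- `S` and its image under `f` are disjoint. In the equality case they fill the vertex set, so each
matched pair meets `S` exactly once. -/
lemma IsPartnerMap.two_mul_card_le [Fintype V] [DecidableEq V] (hf : IsPartnerMap G f)
    {S : Finset V} (hS : G.IsIndepSet (S : Set V)) :
    2 * #S ≤ Fintype.card V ∧ (2 * #S = Fintype.card V → ∀ v, v ∈ S ↔ f v ∉ S) := by
  have inj : Function.Injective f := fun a b hab => by
    rw [← hf.apply_apply a, hab, hf.apply_apply]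
  have himg : #(S.image f) = #S := Finset.card_image_of_injective _ inj
  have hdisj : Disjoint S (S.image f) := by
    rw [Finset.disjoint_left]
    intro v hv hv'
    obtain ⟨w, hw, rfl⟩ := Finset.mem_image.1 hv'
    exact hS hw hv (hf.adj w).ne (hf.adj w)
  have hcard : #(S ∪ S.image f) = 2 * #S := by
    rw [Finset.card_union_of_disjoint hdisj, himg, two_mul]
  refine ⟨hcard ▸ Finset.card_le_univ _, fun heq v => ⟨fun hv hv' => ?_, fun hv => ?_⟩⟩
  · exact hS hv hv' (hf.adj v).ne (hf.adj v)
  · have huniv := Finset.eq_univ_of_card _ (hcard.trans heq)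
    have hmem : f v ∈ S ∪ S.image f := huniv ▸ Finset.mem_univ _
    rcases Finset.mem_union.1 hmem with h | h
    · exact absurd h hv
    · obtain ⟨w, hw, hwv⟩ := Finset.mem_image.1 h
      exact inj hwv ▸ hw

lemma IsBipartition.card_add_card [Fintype V] (h : IsBipartition G A B) :
    #A + #B = Fintype.card V := by
  classical
  rw [← Finset.card_union_of_disjoint h.disjoint, Finset.card_eq_iff_eq_univ]
  ext v
  simpa using h.cover v

lemma IsBipartition.two_mul_card [Fintype V] (h : IsBipartition G A B)
    (hf : IsPartnerMap G f) : 2 * #A = Fintype.card V := by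
  classical
  have h1 := (hf.two_mul_card_le h.isIndepSet_left).1
  have h2 := (hf.two_mul_card_le h.symm.isIndepSet_left).1
  have h3 := h.card_add_card
  omega

/-- A bipartite graph whose two colour classes are both stable sets of maximum size has a
perfect matching. -/
lemma IsBipartition.exists_partnerMap [Finite V] (h : IsBipartition G A B) (hcard : #A = #B)
    (hmax : ∀ S : Finset V, G.IsIndepSet (S : Set V) → #S ≤ #A) : ∃ f, IsPartnerMap G f := by
  classical
  have := Fintype.ofFinite V
  -- Hall's condition: for `X ⊆ A` with neighbourhood `N`, the set `X ∪ (B \ N)` is stable, so its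
  -- size is at most `#A = #B`.
  have hall : ∀ s : Finset A, #s ≤ #(s.biUnion fun a => G.neighborFinset a) := by
    intro s
    set N := s.biUnion fun a => G.neighborFinset a with hN
    have hNB : N ⊆ B := by
      intro w hw
      obtain ⟨a, -, ha⟩ := Finset.mem_biUnion.1 hw
      rw [SimpleGraph.mem_neighborFinset] at ha
      rw [h.mem_right_iff]
      exact (h.mem_iff_of_adj ha).1 a.2
    set X := s.image Subtype.val with hX
    have hXA : X ⊆ A := by
      intro a ha
      obtain ⟨a, -, rfl⟩ := Finset.mem_image.1 ha
      exact a.2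
    have hXN : ∀ x ∈ X, ∀ w, G.Adj x w → w ∈ N := by
      intro x hx w hw
      obtain ⟨a, ha, rfl⟩ := Finset.mem_image.1 hx
      exact Finset.mem_biUnion.2 ⟨a, ha, by simpa using hw⟩
    have hind : G.IsIndepSet ((X ∪ B \ N : Finset V) : Set V) := by
      intro v hv w hw _ hvw
      have h1 := h.mem_iff_of_adj hvw
      have h2 := h.mem_right_iff v
      have h3 := h.mem_right_iff w
      simp only [Finset.mem_coe, Finset.mem_union, Finset.mem_sdiff] at hv hw
      rcases hv with hv | hv <;> rcases hw with hw | hw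
      · exact h1.1 (hXA hv) (hXA hw)
      · exact hw.2 (hXN v hv w hvw)
      · exact hv.2 (hXN w hw v hvw.symm)
      · tauto
    have hle := hmax _ hind
    have hd : Disjoint X (B \ N) :=
      Finset.disjoint_of_subset_left hXA (h.disjoint.mono_right Finset.sdiff_subset)
    have hXc : #X = #s := Finset.card_image_of_injective _ Subtype.val_injective
    rw [Finset.card_union_of_disjoint hd, Finset.card_sdiff_of_subset hNB] at hle
    have := Finset.card_le_card hNB
    omega
  obtain ⟨g, hg, hgN⟩ :=
    (Finset.all_card_le_biUnion_card_iff_exists_injective fun a : A => G.neighborFinset a).1 hall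
  have hadj : ∀ a : A, G.Adj a (g a) := fun a => by simpa using hgN a
  have hgB : ∀ a : A, g a ∈ B := fun a =>
    (h.mem_right_iff _).2 ((h.mem_iff_of_adj (hadj a)).1 a.2)
  have hbij : Function.Bijective fun a : A => (⟨g a, hgB a⟩ : B) := by
    rw [Fintype.bijective_iff_injective_and_card]
    refine ⟨fun a b hab => hg (congrArg Subtype.val hab), by simpa using hcard⟩
  obtain ⟨M, hMv, hM⟩ := SimpleGraph.Subgraph.IsMatching.exists_of_disjoint_sets_of_equiv
    h.toIsBipartiteWith.disjoint (Equiv.ofBijective _ hbij) hadj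
  have hPM : M.IsPerfectMatching := ⟨hM, fun v => hMv ▸ h.cover v⟩
  obtain ⟨f, hf, -⟩ := exists_partnerMap_of_isPerfectMatching hPM
  exact ⟨f, hf⟩

lemma IsBipartition.isIndepSet_combine [DecidableEq V] (h : IsBipartition G A B) {S T : Finset V}
    (hS : G.IsIndepSet (S : Set V)) (hT : G.IsIndepSet (T : Set V)) :
    G.IsIndepSet (((S ∩ T ∩ A) ∪ ((S ∪ T) ∩ B) : Finset V) : Set V) := by
  intro v hv w hw hne hvw
  have h1 := h.mem_iff_of_adj hvw
  have h2 := h.mem_right_iff v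
  have h3 := h.mem_right_iff w
  have h4 : ¬ (v ∈ S ∧ w ∈ S) := fun hh => hS hh.1 hh.2 hne hvw
  have h5 : ¬ (v ∈ T ∧ w ∈ T) := fun hh => hT hh.1 hh.2 hne hvw
  simp only [Finset.mem_coe, Finset.mem_union, Finset.mem_inter] at hv hw
  tauto

lemma IsBipartition.card_eq [DecidableEq V] (h : IsBipartition G A B) (S : Finset V) :
    #S = #(S ∩ A) + #(S ∩ B) := by
  rw [← Finset.card_union_of_disjoint
    (h.disjoint.mono Finset.inter_subset_right Finset.inter_subset_right)]
  congr 1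
  ext v
  have := h.cover v
  simp only [Finset.mem_union, Finset.mem_inter]
  tauto

end Basic

/-! ### Maximum stable sets and `α`-stability -/

section Lattice

variable {V : Type*} [Finite V] {G : SimpleGraph V} {A B : Finset V}

/-- The maximum stable sets of a bipartite graph form a lattice. -/
lemma IsBipartition.isMaximumIndepSet_combine [DecidableEq V] (h : IsBipartition G A B)
    {S T : Finset V} (hS : G.IsMaximumIndepSet S) (hT : G.IsMaximumIndepSet T) :
    G.IsMaximumIndepSet ((S ∩ T ∩ A) ∪ ((S ∪ T) ∩ B)) := by
  refine ⟨h.isIndepSet_combine hS.1 hT.1, fun R hR => (hS.2 R hR).trans ?_⟩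
  have hU' := hT.2 _ (h.symm.isIndepSet_combine hS.1 hT.1)
  have hd1 : Disjoint (S ∩ T ∩ A) ((S ∪ T) ∩ B) :=
    h.disjoint.mono Finset.inter_subset_right Finset.inter_subset_right
  have hd2 : Disjoint (S ∩ T ∩ B) ((S ∪ T) ∩ A) :=
    h.disjoint.symm.mono Finset.inter_subset_right Finset.inter_subset_right
  rw [Finset.card_union_of_disjoint hd2] at hU'
  rw [Finset.card_union_of_disjoint hd1]
  have e1 := h.card_eq (S ∩ T)
  have e2 := h.card_eq (S ∪ T)
  have e3 := Finset.card_union_add_card_inter S T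
  omega

/-- Choose `S` with `#(S ∩ A)` minimal. Combining it with `T` replaces this trace by `S ∩ T ∩ A`, so
minimality forces `S ∩ A ⊆ T`. -/
lemma IsBipartition.exists_isMaximumIndepSet_inter_subset_core (h : IsBipartition G A B) :
    ∃ S : Finset V, G.IsMaximumIndepSet S ∧
      ∀ x ∈ S, x ∈ A → ∀ T, G.IsMaximumIndepSet T → x ∈ T := by
  classical
  have := Fintype.ofFinite V
  obtain ⟨S₀, hS₀⟩ := G.maximumIndepSet_exists
  obtain ⟨S, hS, hmin⟩ := Finset.exists_min_image
    (univ.filter fun S : Finset V => G.IsMaximumIndepSet S) (fun S => #(S ∩ A))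
    ⟨S₀, by simpa using hS₀⟩
  simp only [Finset.mem_filter, Finset.mem_univ, true_and] at hS hmin
  refine ⟨S, hS, fun x hxS hxA T hT => ?_⟩
  by_contra hxT
  have hle := hmin _ (h.isMaximumIndepSet_combine hS hT)
  refine absurd hle (not_le.2 (Finset.card_lt_card ⟨?_, ?_⟩))
  · intro v hv
    have := h.mem_right_iff v
    simp only [Finset.mem_union, Finset.mem_inter] at hv ⊢
    tauto
  · intro hsub
    have hx := hsub (Finset.mem_inter.2 ⟨hxS, hxA⟩)
    have := h.mem_right_iff x
    simp only [Finset.mem_union, Finset.mem_inter] at hx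
    tauto

/-- In an `α⁺`-stable graph at most one vertex lies in all maximum stable sets. -/
lemma IsAlphaPlusStable.core_subsingleton (h : IsAlphaPlusStable G) {x y : V}
    (hx : ∀ T, G.IsMaximumIndepSet T → x ∈ T) (hy : ∀ T, G.IsMaximumIndepSet T → y ∈ T) :
    x = y := by
  by_contra hne
  obtain ⟨S, hS⟩ := G.maximumIndepSet_exists
  have hxy : ¬ G.Adj x y := hS.1 (hx S hS) (hy S hS) hne
  have heq := h s(x, y) (by simpa [hne] using hxy)
  -- `N` is stable in `G` and of size `α(G)`, so it contains both `x` and `y`, which are adjacent in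
  -- the enlarged graph.
  obtain ⟨N, hN⟩ := (G ⊔ SimpleGraph.fromEdgeSet {s(x, y)}).exists_isNIndepSet_indepNum
  have hNmax : G.IsMaximumIndepSet N := by
    refine ⟨isIndepSet_mono le_sup_left hN.1, fun R hR => ?_⟩
    rw [hN.2, heq]
    exact hR.card_le_indepNum
  refine hN.1 (hx N hNmax) (hy N hNmax) hne ?_
  simp [hne]

/-- `T` has at most one vertex `x` in `B`. A neighbour `w ∈ A` of `x` is missing from `T`, so
exchanging `x` for `w` gives `#T ≤ #A`. -/
lemma IsBipartition.card_eq_of_core_subsingleton (h : IsBipartition G A B)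
    (hcore : ∀ x y, (∀ T, G.IsMaximumIndepSet T → x ∈ T) →
      (∀ T, G.IsMaximumIndepSet T → y ∈ T) → x = y)
    (hdeg : ∀ v, ∃ w, G.Adj v w) {S T : Finset V} (hS : G.IsMaximumIndepSet S) (hSB : S ⊆ B)
    (hT : G.IsMaximumIndepSet T) (hTB : ∀ x ∈ T, x ∈ B → ∀ T, G.IsMaximumIndepSet T → x ∈ T) :
    G.IsMaximumIndepSet A ∧ G.IsMaximumIndepSet B := by
  classical
  refine ⟨⟨h.isIndepSet_left, fun R hR => (hT.2 R hR).trans ?_⟩,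
    ⟨h.symm.isIndepSet_left, fun R hR => (hS.2 R hR).trans (Finset.card_le_card hSB)⟩⟩
  by_cases hne : ∃ x ∈ T, x ∈ B
  · obtain ⟨x, hxT, hxB⟩ := hne
    obtain ⟨w, hw⟩ := hdeg x
    have hwA : w ∈ A := by
      have := h.symm.mem_iff_of_adj hw
      have := h.mem_right_iff w
      tauto
    have hwT : w ∉ T := fun hwT => hT.1 hxT hwT hw.ne hw
    have hsub : T ⊆ insert x (A.erase w) := by
      intro v hv
      rw [Finset.mem_insert, Finset.mem_erase]
      rcases h.cover v with hA | hB
      · exact Or.inr ⟨fun hvw => hwT (hvw ▸ hv), hA⟩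
      · exact Or.inl (hcore v x (hTB v hv hB) (hTB x hxT hxB))
    have h1 := Finset.card_le_card hsub
    have h2 := Finset.card_insert_le x (A.erase w)
    have h3 := Finset.card_erase_add_one hwA
    omega
  · push Not at hne
    exact Finset.card_le_card fun v hv => (h.cover v).resolve_right (hne v hv)

/-- The traces `S ∩ A` and `T ∩ B` of the two extremal sets lie in the core, which has at most one
vertex; as `A` and `B` are disjoint, one trace is empty. -/
lemma IsAlphaPlusStable.isMaximumIndepSet_colourClasses (hs : IsAlphaPlusStable G)
    (h : IsBipartition G A B) (hdeg : ∀ v, ∃ w, G.Adj v w) :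
    G.IsMaximumIndepSet A ∧ G.IsMaximumIndepSet B := by
  obtain ⟨S, hS, hSA⟩ := h.exists_isMaximumIndepSet_inter_subset_core
  obtain ⟨T, hT, hTB⟩ := h.symm.exists_isMaximumIndepSet_inter_subset_core
  have hcore := fun x y hx hy => hs.core_subsingleton (x := x) (y := y) hx hy
  by_cases hSe : ∃ x ∈ S, x ∈ A
  · by_cases hTe : ∃ y ∈ T, y ∈ B
    · obtain ⟨x, hxS, hxA⟩ := hSe
      obtain ⟨y, hyT, hyB⟩ := hTe
      have := hcore x y (hSA x hxS hxA) (hTB y hyT hyB)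
      exact absurd hxA ((h.mem_right_iff x).1 (this ▸ hyB))
    · push Not at hTe
      exact (h.symm.card_eq_of_core_subsingleton hcore hdeg hT
        (fun v hv => (h.cover v).resolve_right (hTe v hv)) hS hSA).symm
  · push Not at hSe
    exact h.card_eq_of_core_subsingleton hcore hdeg hS
      (fun v hv => (h.cover v).resolve_left (hSe v hv)) hT hTB

lemma IsAlphaStable.avoidsPairs (hs : IsAlphaStable G)
    (h : IsBipartition G A B) (hdeg : ∀ v, ∃ w, G.Adj v w) : AvoidsPairs G := by
  obtain ⟨hA, hB⟩ := hs.2.isMaximumIndepSet_colourClasses h hdeg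
  have hAB : #A = #B := le_antisymm (hB.2 _ hA.1) (hA.2 _ hB.1)
  intro x y
  by_cases hxy : G.Adj x y
  · have hle : G.deleteEdges {s(x, y)} ≤ G := SimpleGraph.deleteEdges_le _
    obtain ⟨f, hf⟩ := (h.mono hle).exists_partnerMap hAB (fun S hS => by
      have := hS.card_le_indepNum
      rwa [hs.1 s(x, y) hxy, ← G.maximumIndepSet_card_eq_indepNum A hA] at this)
    refine ⟨f, hf.mono hle, ?_⟩
    rintro rfl
    simpa using hf.adj x
  · obtain ⟨f, hf⟩ := h.exists_partnerMap hAB hA.2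
    exact ⟨f, hf, fun hfx => hxy (hfx ▸ hf.adj x)⟩

/-- A perfect matching avoiding a deleted edge still bounds stable sets by half the vertices. An
added edge lies inside at most one class, so the other class or both remain stable. -/
lemma AvoidsPairs.isAlphaStable [Nonempty V] (hP : AvoidsPairs G) (h : IsBipartition G A B) :
    IsAlphaStable G := by
  classical
  have := Fintype.ofFinite V
  have mono : ∀ {H K : SimpleGraph V}, H ≤ K → K.indepNum ≤ H.indepNum := by
    intro H K hle
    obtain ⟨N, hN⟩ := K.exists_isNIndepSet_indepNum
    rw [← hN.2]
    exact (isIndepSet_mono hle hN.1).card_le_indepNum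
  constructor
  · intro e he
    refine le_antisymm ?_ (mono (SimpleGraph.deleteEdges_le _))
    induction e with | _ x y
    obtain ⟨f, hf, hfx⟩ := hP x y
    have hf' : IsPartnerMap (G.deleteEdges {s(x, y)}) f := by
      refine ⟨hf.apply_apply, fun v => ?_⟩
      rw [SimpleGraph.deleteEdges_adj]
      refine ⟨hf.adj v, fun hv => ?_⟩
      rcases Sym2.eq_iff.1 (Set.mem_singleton_iff.1 hv) with ⟨rfl, h2⟩ | ⟨rfl, h2⟩
      · exact hfx h2
      · exact hfx (h2 ▸ hf.apply_apply v)
    obtain ⟨N, hN⟩ := (G.deleteEdges {s(x, y)}).exists_isNIndepSet_indepNum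
    have h1 := (hf'.two_mul_card_le hN.1).1
    have h2 := h.two_mul_card hf
    have h3 := h.isIndepSet_left.card_le_indepNum
    rw [← hN.2]
    omega
  · intro e he
    refine le_antisymm (mono le_sup_left) ?_
    induction e with | _ x y
    obtain ⟨f, hf, -⟩ := hP x y
    obtain ⟨N, hN⟩ := G.exists_isNIndepSet_indepNum
    have h1 := (hf.two_mul_card_le hN.1).1
    have h2 := h.two_mul_card hf
    have h3 := h.symm.two_mul_card hf
    have key : ∀ {C D : Finset V}, IsBipartition G C D → (x ∈ C → y ∉ C) →
        #C ≤ (G ⊔ SimpleGraph.fromEdgeSet {s(x, y)}).indepNum := by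
      intro C D hC hxy
      refine SimpleGraph.IsIndepSet.card_le_indepNum fun v hv w hw hne hvw => ?_
      rcases hvw with hvw | hvw
      · exact hC.isIndepSet_left hv hw hne hvw
      · rw [SimpleGraph.fromEdgeSet_adj] at hvw
        rcases Sym2.eq_iff.1 (Set.mem_singleton_iff.1 hvw.1) with ⟨rfl, rfl⟩ | ⟨rfl, rfl⟩
        · exact hxy hv hw
        · exact hxy hw hv
    rw [← hN.2]
    by_cases hxy : x ∈ A ∧ y ∈ A
    · have := key h.symm fun hx => absurd hxy.1 ((h.mem_right_iff x).1 hx)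
      omega
    · have := key h fun hx hy => hxy ⟨hx, hy⟩
      omega

end Lattice

/-! ### Bistable decompositions -/

section Decomposition

/-- A bistable bipartite graph on at least four vertices remains perfectly matchable when any
edge is deleted. -/
lemma IsBistableBipartite.avoidsPairs {W : Type*} [Finite W] {H : SimpleGraph W}
    (h : IsBistableBipartite H) (hcard : 4 ≤ Nat.card W) : AvoidsPairs H := by
  classical
  have := Fintype.ofFinite W
  obtain ⟨A, B, hAB, hcov, hne, hmax⟩ := h
  have hb : IsBipartition H A B := ⟨hAB, fun v => by
    have : v ∈ (A : Set W) ∪ (B : Set W) := hcov ▸ Set.mem_univ v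
    simpa using this⟩
  have hA : H.IsMaximumIndepSet A := (hmax A).2 (Or.inl rfl)
  have hB : H.IsMaximumIndepSet B := (hmax B).2 (Or.inr rfl)
  have hc : #A = #B := le_antisymm (hB.2 _ hA.1) (hA.2 _ hB.1)
  have hsum := hb.card_add_card
  rw [Nat.card_eq_fintype_card] at hcard
  intro x y
  have hle : H.deleteEdges {s(x, y)} ≤ H := SimpleGraph.deleteEdges_le _
  obtain ⟨f, hf⟩ := (hb.mono hle).exists_partnerMap hc (fun S hS => by
    -- A stable set `S` of `H - xy` larger than `A` contains `x` and `y`. Removing either leaves a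
    -- maximum stable set of `H`, so the two results are `A` and `B`; being disjoint, they force `S
    -- ⊆ {x, y}`, too small for four vertices.
    by_contra! hlt
    have erase_max : ∀ z, (z = x ∨ z = y) → z ∈ S → S.erase z = A ∨ S.erase z = B := by
      intro z hz hzS
      rw [← hmax]
      refine ⟨fun v hv w hw hvw hadj => ?_, fun R hR => (hA.2 R hR).trans ?_⟩
      · simp only [Finset.coe_erase, Set.mem_sdiff, Finset.mem_coe, Set.mem_singleton_iff] at hv hw
        refine hS hv.1 hw.1 hvw ?_
        rw [SimpleGraph.deleteEdges_adj]
        refine ⟨hadj, fun hmem => ?_⟩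
        have := Sym2.eq_iff.1 (Set.mem_singleton_iff.1 hmem)
        grind
      · have := Finset.card_erase_add_one hzS
        omega
    have hxyS : x ∈ S ∧ y ∈ S ∧ x ≠ y := by
      by_contra hcon
      refine absurd (hA.2 S fun v hv w hw hvw hadj => hS hv hw hvw ?_) (not_le.2 hlt)
      rw [SimpleGraph.deleteEdges_adj]
      refine ⟨hadj, fun hmem => ?_⟩
      rw [Finset.mem_coe] at hv hw
      have := Sym2.eq_iff.1 (Set.mem_singleton_iff.1 hmem)
      grind
    obtain ⟨hx, hy, hxy⟩ := hxyS
    have h1 := erase_max x (Or.inl rfl) hx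
    have h2 := erase_max y (Or.inr rfl) hy
    have hdiff : S.erase x ≠ S.erase y := fun heq => by
      have : y ∈ S.erase x := Finset.mem_erase.2 ⟨hxy.symm, hy⟩
      simp [heq] at this
    have hdisj : Disjoint (S.erase x) (S.erase y) := by
      have hd := hb.disjoint
      rcases h1 with h1 | h1 <;> rcases h2 with h2 | h2 <;> rw [h1, h2] at hdiff ⊢
      · exact absurd rfl hdiff
      · exact hd
      · exact hd.symm
      · exact absurd rfl hdiff
    have hsub : S ⊆ {x, y} := by
      intro z hz
      by_contra hz'
      simp only [Finset.mem_insert, Finset.mem_singleton, not_or] at hz'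
      exact Finset.disjoint_left.1 hdisj (Finset.mem_erase.2 ⟨hz'.1, hz⟩)
        (Finset.mem_erase.2 ⟨hz'.2, hz⟩)
    have := Finset.card_le_card hsub
    have := Finset.card_le_two (a := x) (b := y)
    omega)
  refine ⟨f, hf.mono hle, ?_⟩
  rintro rfl
  simpa using hf.adj x

variable {V : Type*} {G : SimpleGraph V}

/-- Partner maps of the parts of a vertex partition can be glued. -/
lemma exists_partnerMap_of_partition {ι : Type*} {U : ι → Set V}
    (hdisj : Pairwise fun i j => Disjoint (U i) (U j)) (hcov : (⋃ i, U i) = Set.univ)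
    {f : ∀ i, U i → U i} (hf : ∀ i, IsPartnerMap (G.induce (U i)) (f i)) :
    ∃ F, IsPartnerMap G F ∧ ∀ i (v : U i), F v = f i v := by
  have hex : ∀ v, ∃ i, v ∈ U i := fun v => by
    have : v ∈ ⋃ i, U i := hcov ▸ Set.mem_univ v
    simpa using this
  choose i hi using hex
  have key : ∀ j (v : U j), (f (i v) ⟨v, hi v⟩ : V) = f j v := by
    rintro j ⟨v, hv⟩
    have : i v = j := by
      by_contra hne
      exact Set.disjoint_left.1 (hdisj hne) (hi v) hv
    subst this
    rfl
  refine ⟨fun v => f (i v) ⟨v, hi v⟩, ⟨fun v => ?_, fun v => ?_⟩, key⟩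
  · rw [key, (hf _).apply_apply]
  · exact (hf (i v)).adj ⟨v, hi v⟩

lemma HasBistableDecomposition.avoidsPairs [Finite V] (h : HasBistableDecomposition G) :
    AvoidsPairs G := by
  obtain ⟨k, U, -, hdisj, hcov, hU⟩ := h
  intro x y
  have hex : ∀ i, ∃ f, IsPartnerMap (G.induce (U i)) f ∧
      ∀ v : U i, (v : V) = x → (f v : V) ≠ y := by
    intro i
    have hP := (hU i).1.avoidsPairs (hU i).2
    by_cases hxy : x ∈ U i ∧ y ∈ U i
    · obtain ⟨f, hf, hfx⟩ := hP ⟨x, hxy.1⟩ ⟨y, hxy.2⟩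
      refine ⟨f, hf, ?_⟩
      rintro ⟨v, hv⟩ rfl hfv
      exact hfx (Subtype.ext hfv)
    · have hne : (U i).Nonempty := by
        rw [← Set.ncard_pos]
        have := (hU i).2
        omega
      obtain ⟨f, hf, -⟩ := hP ⟨_, hne.some_mem⟩ ⟨_, hne.some_mem⟩
      refine ⟨f, hf, ?_⟩
      rintro v rfl rfl
      exact hxy ⟨v.2, (f v).2⟩
  choose f hf hfx using hex
  obtain ⟨F, hF, hFf⟩ := exists_partnerMap_of_partition hdisj hcov hf
  refine ⟨F, hF, ?_⟩
  have : x ∈ ⋃ i, U i := hcov ▸ Set.mem_univ x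
  obtain ⟨i, hi⟩ := Set.mem_iUnion.1 this
  rw [hFf i ⟨x, hi⟩]
  exact hfx i _ rfl

/-- The graph formed by the edges of `G` that lie in some perfect matching of `G`. -/
def matchableGraph {V : Type*} (G : SimpleGraph V) : SimpleGraph V where
  Adj v w := ∃ f, IsPartnerMap G f ∧ f v = w
  symm := ⟨by
    rintro v w ⟨f, hf, rfl⟩
    exact ⟨f, hf, hf.apply_apply v⟩⟩
  loopless := ⟨by
    rintro v ⟨f, hf, hv⟩
    exact (hf.adj v).ne hv.symm⟩

lemma IsPartnerMap.mem_supp {f : V → V} (hf : IsPartnerMap G f)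
    {c : (matchableGraph G).ConnectedComponent} {v : V} (hv : v ∈ c.supp) : f v ∈ c.supp := by
  have hadj : (matchableGraph G).Adj v (f v) := ⟨f, hf, rfl⟩
  rw [SimpleGraph.ConnectedComponent.mem_supp_iff] at hv ⊢
  rw [← hv]
  exact SimpleGraph.ConnectedComponent.sound hadj.symm.reachable

lemma AvoidsPairs.four_le_ncard_supp [Finite V] (hP : AvoidsPairs G)
    (c : (matchableGraph G).ConnectedComponent) : 4 ≤ c.supp.ncard := by
  classical
  obtain ⟨a, ha⟩ := c.nonempty_supp
  -- No partner map fixes a vertex, so the pair `(a, a)` asks only for existence.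
  obtain ⟨f, hf, -⟩ := hP a a
  obtain ⟨g, hg, hga⟩ := hP a (f a)
  have hsub : (({a, f a, g a, f (g a)} : Finset V) : Set V) ⊆ c.supp := by
    intro v hv
    simp only [Finset.coe_insert, Finset.coe_singleton, Set.mem_insert_iff,
      Set.mem_singleton_iff] at hv
    rcases hv with rfl | rfl | rfl | rfl
    · exact ha
    · exact hf.mem_supp ha
    · exact hg.mem_supp ha
    · exact hf.mem_supp (hg.mem_supp ha)
  have hcard : #({a, f a, g a, f (g a)} : Finset V) = 4 := by
    have h1 := (hf.adj a).ne
    have h2 := (hg.adj a).ne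
    have h3 := (hf.adj (g a)).ne
    have h4 : a ≠ f (g a) := fun h => hga (by rw [h, hf.apply_apply, ← h])
    have h5 : f a ≠ f (g a) := fun h =>
      h2 ((hf.apply_apply a).symm.trans ((congrArg f h).trans (hf.apply_apply _)))
    simp [hga.symm, h1, h2, h3, h4, h5]
  calc 4 = (({a, f a, g a, f (g a)} : Finset V) : Set V).ncard := by
        rw [Set.ncard_coe_finset, hcard]
    _ ≤ c.supp.ncard := Set.ncard_le_ncard hsub

/-- Both `A` and a maximum stable set `S` contain exactly one end of each matchable edge. Agreement
of `S` with `A` at a vertex thus propagates through the component. -/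
lemma AvoidsPairs.isBistableBipartite_supp [Finite V] {A B : Finset V} (hP : AvoidsPairs G)
    (h : IsBipartition G A B) (c : (matchableGraph G).ConnectedComponent) :
    IsBistableBipartite (G.induce c.supp) := by
  classical
  have := Fintype.ofFinite V
  have hres : ∀ f, IsPartnerMap G f → ∃ f' : c.supp → c.supp,
      IsPartnerMap (G.induce c.supp) f' ∧ ∀ v, (f' v : V) = f v := fun f hf =>
    ⟨fun v => ⟨f v, hf.mem_supp v.2⟩,
      ⟨fun v => Subtype.ext (hf.apply_apply v), fun v => hf.adj v⟩, fun _ => rfl⟩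
  obtain ⟨a, ha⟩ := c.nonempty_supp
  obtain ⟨f₀, hf₀, -⟩ := hP a a
  obtain ⟨f, hf, -⟩ := hres f₀ hf₀
  let A' : Finset c.supp := univ.filter fun v => (v : V) ∈ A
  let B' : Finset c.supp := univ.filter fun v => (v : V) ∈ B
  have memA : ∀ v : c.supp, v ∈ A' ↔ (v : V) ∈ A := fun v => by simp [A']
  have memB : ∀ v : c.supp, v ∈ B' ↔ (v : V) ∈ B := fun v => by simp [B']
  have hb : IsBipartition (G.induce c.supp) A' B' := by
    refine ⟨⟨?_, ?_⟩, fun v => ?_⟩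
    · rw [Finset.disjoint_coe, Finset.disjoint_left]
      intro v hv hv'
      rw [memA] at hv
      rw [memB] at hv'
      exact Finset.disjoint_left.1 h.disjoint hv hv'
    · intro v w hvw
      simp only [Finset.mem_coe, memA, memB]
      exact h.toIsBipartiteWith.mem_of_adj hvw
    · rw [memA, memB]
      exact h.cover v
  have hA := hb.two_mul_card hf
  have hB := hb.symm.two_mul_card hf
  have hmax : ∀ {S : Finset c.supp}, (G.induce c.supp).IsIndepSet (S : Set c.supp) →
      2 * #S = Fintype.card c.supp → (G.induce c.supp).IsMaximumIndepSet S := by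
    intro S hS hc
    refine ⟨hS, fun R hR => ?_⟩
    have := (hf.two_mul_card_le hR).1
    omega
  refine ⟨A', B', hb.toIsBipartiteWith, ?_, ?_, fun S => ⟨fun hS => ?_, ?_⟩⟩
  · ext v
    simpa using hb.cover v
  · intro heq
    have h1 := hb.mem_right_iff ⟨a, ha⟩
    rw [heq] at h1
    tauto
  · have hcard : 2 * #S = Fintype.card c.supp := by
      have h1 := (hf.two_mul_card_le hS.1).1
      have h2 := hS.2 _ hb.isIndepSet_left
      omega
    have hstep : ∀ v w : c.supp, (matchableGraph G).Adj v w →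
        ((v ∈ S ↔ (v : V) ∈ A) ↔ (w ∈ S ↔ (w : V) ∈ A)) := by
      rintro v w ⟨g₀, hg₀, hgv⟩
      obtain ⟨g, hg, hgg⟩ := hres g₀ hg₀
      have hw : g v = w := Subtype.ext ((hgg v).trans hgv)
      have h1 := (hg.two_mul_card_le hS.1).2 hcard v
      have h2 := h.mem_iff_of_adj (hg₀.adj v)
      rw [hw] at h1
      rw [hgv] at h2
      tauto
    have hreach : ∀ {v w : V}, (matchableGraph G).Walk v w → ∀ (hv : v ∈ c.supp)
        (hw : w ∈ c.supp), ((⟨v, hv⟩ ∈ S ↔ v ∈ A) ↔ (⟨w, hw⟩ ∈ S ↔ w ∈ A)) := by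
      intro v w p
      induction p with
      | nil => intro _ _; rfl
      | @cons u v w hadj p ih =>
        intro hu hw
        have hv : v ∈ c.supp := by
          obtain ⟨g, hg, rfl⟩ := hadj
          exact hg.mem_supp hu
        exact (hstep ⟨u, hu⟩ ⟨v, hv⟩ hadj).trans (ih hv hw)
    have hall : ∀ v : c.supp, ((⟨a, ha⟩ ∈ S ↔ a ∈ A) ↔ (v ∈ S ↔ (v : V) ∈ A)) := by
      intro v
      obtain ⟨p⟩ := c.reachable_of_mem_supp ha v.2
      exact hreach p ha v.2
    by_cases hcase : (⟨a, ha⟩ ∈ S ↔ a ∈ A)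
    · left
      ext v
      have := hall v
      rw [memA]
      tauto
    · right
      ext v
      have := hall v
      have := h.mem_right_iff (v : V)
      rw [memB]
      tauto
  · rintro (rfl | rfl)
    · exact hmax hb.isIndepSet_left hA
    · exact hmax hb.symm.isIndepSet_left hB

lemma AvoidsPairs.hasBistableDecomposition [Finite V] [Nonempty V] {A B : Finset V}
    (hP : AvoidsPairs G) (h : IsBipartition G A B) : HasBistableDecomposition G := by
  have e := Finite.equivFin (matchableGraph G).ConnectedComponent
  refine ⟨_, fun i => (e.symm i).supp, Nat.card_pos, fun i j hij => ?_, ?_, fun i =>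
    ⟨hP.isBistableBipartite_supp h _, hP.four_le_ncard_supp _⟩⟩
  · exact (matchableGraph G).pairwise_disjoint_supp_connectedComponent (e.symm.injective.ne hij)
  · rw [e.symm.surjective.iUnion_comp fun c => c.supp]
    exact (matchableGraph G).iUnion_connectedComponentSupp

end Decomposition

/-! ### Perfect matchings and alternating cycles -/

section Matchings

variable {V : Type*} {G : SimpleGraph V}

lemma avoidsPairs_iff_iInter_eq_empty [Nonempty V] : AvoidsPairs G ↔
    (∃ M : G.Subgraph, M.IsPerfectMatching) ∧
      (⋂ M ∈ {M : G.Subgraph | M.IsPerfectMatching}, M.edgeSet) = (∅ : Set (Sym2 V)) := by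
  constructor
  · intro hP
    constructor
    · obtain ⟨v⟩ := ‹Nonempty V›
      obtain ⟨f, hf, -⟩ := hP v v
      obtain ⟨M, hM, -⟩ := hf.exists_isPerfectMatching
      exact ⟨M, hM⟩
    · rw [Set.eq_empty_iff_forall_notMem]
      intro e he
      induction e with | _ x y
      obtain ⟨f, hf, hfx⟩ := hP x y
      obtain ⟨M, hM, hMf⟩ := hf.exists_isPerfectMatching
      exact hfx ((hMf x y).1 (Set.mem_iInter₂.1 he M hM))
  -- Without perfect matchings the intersection would be all of `Sym2 V`, so its emptiness alone
  -- suffices.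
  · rintro ⟨-, hM⟩ x y
    have hnot := Set.eq_empty_iff_forall_notMem.1 hM s(x, y)
    simp only [Set.mem_iInter, not_forall] at hnot
    obtain ⟨M, hM, hxy⟩ := hnot
    obtain ⟨f, hf, hfM⟩ := exists_partnerMap_of_isPerfectMatching hM
    exact ⟨f, hf, fun h => hxy ((hfM x y).2 h)⟩

lemma avoidsPairs_iff_two_le_ncard [Finite V] : AvoidsPairs G ↔
    ∀ v : V, 2 ≤ {e : Sym2 V | e ∈ G.incidenceSet v ∧
        ∃ M : G.Subgraph, M.IsPerfectMatching ∧ e ∈ M.edgeSet}.ncard := by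
  constructor
  · intro hP v
    obtain ⟨f, hf, -⟩ := hP v v
    obtain ⟨g, hg, hgv⟩ := hP v (f v)
    have mem : ∀ {k}, IsPartnerMap G k → s(v, k v) ∈ {e : Sym2 V | e ∈ G.incidenceSet v ∧
        ∃ M : G.Subgraph, M.IsPerfectMatching ∧ e ∈ M.edgeSet} := by
      intro k hk
      obtain ⟨M, hM, hMk⟩ := hk.exists_isPerfectMatching
      exact ⟨⟨hk.adj v, Sym2.mem_mk_left _ _⟩, M, hM, (hMk _ _).2 rfl⟩
    refine (Set.one_lt_ncard (Set.toFinite _)).2 ⟨_, mem hf, _, mem hg, fun heq => hgv ?_⟩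
    exact (Sym2.congr_right.1 heq).symm
  · intro h x y
    obtain ⟨e, he, e', he', hne⟩ := (Set.one_lt_ncard (Set.toFinite _)).1 (h x)
    have main : ∀ e ∈ {e : Sym2 V | e ∈ G.incidenceSet x ∧
        ∃ M : G.Subgraph, M.IsPerfectMatching ∧ e ∈ M.edgeSet}, e ≠ s(x, y) →
        ∃ f, IsPartnerMap G f ∧ f x ≠ y := by
      rintro e ⟨hinc, M, hM, heM⟩ hexy
      obtain ⟨w, rfl⟩ := Sym2.mem_iff_exists.1 hinc.2
      obtain ⟨f, hf, hfM⟩ := exists_partnerMap_of_isPerfectMatching hM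
      refine ⟨f, hf, fun hfx => hexy ?_⟩
      rw [← hfx, (hfM x w).1 heM]
    by_cases hexy : e = s(x, y)
    · exact main e' he' fun h => hne (hexy.trans h.symm)
    · exact main e he hexy

lemma avoidsPairs_iff_alternatingCycle [Finite V] : AvoidsPairs G ↔
    ∀ v : V, ∃ (u : V) (p : G.Walk u u), IsAlternatingCycle G p ∧ v ∈ p.support := by
  constructor
  · intro hP v
    obtain ⟨f, hf, -⟩ := hP v v
    obtain ⟨g, hg, hgv⟩ := hP v (f v)
    obtain ⟨M, hM, hMf⟩ := hf.exists_isPerfectMatching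
    obtain ⟨N, hN, hNg⟩ := hg.exists_isPerfectMatching
    set D := symmDiff M.spanningCoe N.spanningCoe with hD
    have hDG : D ≤ G :=
      symmDiff_le (M.spanningCoe_le.trans le_sup_right) (N.spanningCoe_le.trans le_sup_right)
    have hadj : D.Adj v (f v) := by
      rw [hD, symmDiff_def, SimpleGraph.sup_adj, SimpleGraph.sdiff_adj]
      simp only [SimpleGraph.Subgraph.spanningCoe_adj, hMf, hNg]
      exact Or.inl ⟨trivial, hgv⟩
    obtain ⟨p, hp, -⟩ :=
      (hM.symmDiff_isCycles hN).exists_cycle_toSubgraph_verts_eq_connectedComponentSupp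
        (c := D.connectedComponentMk v) rfl ⟨_, hadj⟩
    refine ⟨v, p.mapLe hDG, ⟨hp.mapLe hDG, M, hM, ?_⟩, SimpleGraph.Walk.start_mem_support _⟩
    refine (hM.isAlternating_symmDiff_left hN).mono fun a b hab => ?_
    rw [SimpleGraph.Subgraph.spanningCoe_adj, SimpleGraph.Walk.adj_toSubgraph_mapLe] at hab
    exact hab.adj_sub
  · intro h x y
    obtain ⟨u, p, ⟨hp, M, hM, halt⟩, hx⟩ := h x
    -- Switching `M` along the cycle changes the partner of `x`, so `M` or the switched matching
    -- avoids `(x, y)`.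
    have hPM := hM.symmDiff_of_isAlternating halt hp.isCycles_spanningCoe_toSubgraph
    obtain ⟨f, hf, hfM⟩ := exists_partnerMap_of_isPerfectMatching hM
    obtain ⟨g, hg, hgM⟩ := exists_partnerMap_of_isPerfectMatching hPM
    have hle : symmDiff M.spanningCoe p.toSubgraph.spanningCoe ≤ G :=
      symmDiff_le (M.spanningCoe_le.trans le_sup_right)
        (p.toSubgraph.spanningCoe_le.trans le_sup_right)
    by_cases hfx : f x = y
    · refine ⟨g, hg.mono hle, fun hgx => ?_⟩
      have h2 := hp.ncard_neighborSet_toSubgraph_eq_two hx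
      obtain ⟨b, b', hbb, hb⟩ := Set.ncard_eq_two.1 h2
      have hxb : p.toSubgraph.Adj x b := by
        rw [← SimpleGraph.Subgraph.mem_neighborSet, hb]; simp
      have hxb' : p.toSubgraph.Adj x b' := by
        rw [← SimpleGraph.Subgraph.mem_neighborSet, hb]; simp
      have hxor := halt hbb hxb hxb'
      simp only [SimpleGraph.Subgraph.spanningCoe_adj, hfM, hfx] at hxor
      have hgD := hg.adj x
      rw [hgx, symmDiff_def, SimpleGraph.sup_adj, SimpleGraph.sdiff_adj, SimpleGraph.sdiff_adj]
        at hgD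
      simp only [SimpleGraph.Subgraph.spanningCoe_adj, hfM, hfx] at hgD
      by_cases hyb : y = b
      · subst hyb; tauto
      · have : y = b' := by tauto
        subst this; tauto
    · exact ⟨f, hf, hfx⟩

end Matchings

end AlphaStable

theorem theorem5p6 {V : Type*} [Finite V] [Nontrivial V] (G : SimpleGraph V)
    (hconn : G.Connected) (hbip : G.IsBipartite) :
    List.TFAE [
      AlphaStable.IsAlphaStable G,
      AlphaStable.HasBistableDecomposition G,
      (∃ M : G.Subgraph, M.IsPerfectMatching) ∧
        (⋂ M ∈ {M : G.Subgraph | M.IsPerfectMatching}, M.edgeSet) = (∅ : Set (Sym2 V)),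
      ∀ v : V, 2 ≤ {e : Sym2 V | e ∈ G.incidenceSet v ∧
        ∃ M : G.Subgraph, M.IsPerfectMatching ∧ e ∈ M.edgeSet}.ncard,
      ∀ v : V, ∃ (u : V) (p : G.Walk u u),
        AlphaStable.IsAlternatingCycle G p ∧ v ∈ p.support] := by
  obtain ⟨A, B, h⟩ := AlphaStable.exists_isBipartition hbip
  -- This turns the last three conditions into literally `AvoidsPairs G`.
  rw [← AlphaStable.avoidsPairs_iff_iInter_eq_empty, ← AlphaStable.avoidsPairs_iff_two_le_ncard,
    ← AlphaStable.avoidsPairs_iff_alternatingCycle]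
  tfae_have 1 → 3 := fun hs => hs.avoidsPairs h hconn.preconnected.exists_adj_of_nontrivial
  tfae_have 3 → 1 := fun hP => hP.isAlphaStable h
  tfae_have 2 → 3 := fun hD => hD.avoidsPairs
  tfae_have 3 → 2 := fun hP => hP.hasBistableDecomposition h
  tfae_have 3 ↔ 4 := Iff.rfl
  tfae_have 4 ↔ 5 := Iff.rfl
  tfae_finish
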